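/- Let $S$ be a Polish space with its Borel $\sigma$-algebra. Let $V : S\times S\to[0,\infty)$ be a divergence function, that is, $V$ is lower semicontinuous on $S\times S$ and (i) $V(s_1,s_2)=0$ if and only if $s_1=s_2$; (ii) $V(s_1,s_2)=V(s_2,s_1)$ for all $s_1,s_2\in S$; (iii) for every $q\ge 0$ and every compact set $K\subset S$ there is a compact set $L\subset S$ such that $\inf_{(s_1,s_2)\in (S\setminus L)\times K}V(s_1,s_2)\ge q$ (the infimum over the empty set being $\infty$). For Borel measures $\mu_1,\mu_2$ on $S$, let $C(\mu_1,\mu_2)$ be the set of all probability measures on $S\times S$ with first marginal $\mu_1$ and second marginal $\mu_2$, and define the Wasserstein divergence $$W_V(\mu_1,\mu_2)=\inf_{\xi\in C(\mu_1,\mu_2)}\int_{S\times S}V(s,s')\,d\xi(s,s')\in[0,\infty]$$ (equal to $\infty$ if $C(\mu_1,\mu_2)$ is empty). Let $(\mu_k)_{k\in\mathbb N}$ and $(\nu_k)_{k\in\mathbb N}$ be sequences of Borel probability measures on $S$, and let $\theta_\mu,\theta_\nu$ be Borel measures on $S$ such that $\mu_k\to\theta_\mu$ and $\nu_k\to\theta_\nu$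 in the Wasserstein divergence, i.e. $\lim_{k\to\infty}W_V(\mu_k,\theta_\mu)=0$ and $\lim_{k\to\infty}W_V(\nu_k,\theta_\nu)=0$. If $\lim_{k\to\infty}W_V(\mu_k,\nu_k)=0$, then $\theta_\mu=\theta_\nu$. -/

import Mathlib

open Filter Topology MeasureTheory
open scoped NNReal ENNReal

/-- Divergence functions `V : S × S → [0, ∞)` on a topological space `S`. -/
structure IsDivergence {S : Type*} [TopologicalSpace S] (V : S × S → ℝ≥0) : Prop where
  lowerSemicontinuous : LowerSemicontinuous V
  eq_zero_iff : ∀ s₁ s₂ : S, V (s₁, s₂) = 0 ↔ s₁ = s₂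
  symm : ∀ s₁ s₂ : S, V (s₁, s₂) = V (s₂, s₁)
  /-- Inf-compactness. The infimum is taken in `[0, ∞]`, so that over the empty set it is `∞`. -/
  inf_compact : ∀ (q : ℝ≥0) (K : Set S), IsCompact K →
    ∃ L : Set S, IsCompact L ∧ (q : ℝ≥0∞) ≤ ⨅ p ∈ Lᶜ ×ˢ K, (V p : ℝ≥0∞)

/-- The set `C(μ₁, μ₂)` of couplings: the probability measures on `S × S` whose first marginal
is `μ₁` and whose second marginal is `μ₂`. -/
def couplings {S : Type*} [MeasurableSpace S] (μ₁ μ₂ : Measure S) : Set (Measure (S × S)) :=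
  {ξ | IsProbabilityMeasure ξ ∧ ξ.fst = μ₁ ∧ ξ.snd = μ₂}

/-- The Wasserstein divergence `W_V(μ₁, μ₂) = inf_{ξ ∈ C(μ₁, μ₂)} ∫ V dξ`, with values in
`[0, ∞]`. It is `∞` if there is no coupling, that is, if `μ₁` or `μ₂` is not a probability
measure. -/
noncomputable def wassersteinDivergence {S : Type*} [MeasurableSpace S]
    (V : S × S → ℝ≥0) (μ₁ μ₂ : Measure S) : ℝ≥0∞ :=
  ⨅ ξ ∈ couplings μ₁ μ₂, ∫⁻ p, (V p : ℝ≥0∞) ∂ξ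

/-- Convergence of a sequence of measures to `θ` in the Wasserstein divergence. -/
def TendstoInWassersteinDivergence {S : Type*} [MeasurableSpace S]
    (V : S × S → ℝ≥0) (μ : ℕ → Measure S) (θ : Measure S) : Prop :=
  Tendsto (fun k => wassersteinDivergence V (μ k) θ) atTop (𝓝 0)

/-- A divergence is bounded below by a positive constant on pairs whose second coordinate lies in a
given compact set and on which a continuous function oscillates by at least `δ`. -/
theorem IsDivergence.exists_pos_le {S : Type*} [TopologicalSpace S] [T2Space S]
    {V : S × S → ℝ≥0} (hV : IsDivergence V) {K : Set S} (hK : IsCompact K)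
    {f : S → ℝ} (hf : Continuous f) {δ : ℝ} (hδ : 0 < δ) :
    ∃ c : ℝ≥0, 0 < c ∧ ∀ p : S × S, p.2 ∈ K → δ ≤ |f p.1 - f p.2| → c ≤ V p := by
  obtain ⟨L, hL, hLV⟩ := hV.inf_compact 1 K hK
  have hout : ∀ p : S × S, p.1 ∉ L → p.2 ∈ K → 1 ≤ V p := fun p h₁ h₂ => by
    exact_mod_cast hLV.trans (iInf₂_le p ⟨h₁, h₂⟩)
  set B : Set (S × S) := {p | δ ≤ |f p.1 - f p.2|} with hB
  have hBc : IsClosed B := isClosed_le continuous_const (by fun_prop)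
  have hcomp : IsCompact ((L ×ˢ K) ∩ B) := (hL.prod hK).inter_right hBc
  rcases ((L ×ˢ K) ∩ B).eq_empty_or_nonempty with he | hne
  · refine ⟨1, one_pos, fun p h₂ hp => ?_⟩
    refine hout p (fun h₁ => ?_) h₂
    have : p ∈ (L ×ˢ K) ∩ B := ⟨⟨h₁, h₂⟩, hp⟩
    simp [he] at this
  · obtain ⟨a, ha, hmin⟩ :=
      LowerSemicontinuousOn.exists_isMinOn hne hcomp (hV.lowerSemicontinuous.lowerSemicontinuousOn _)
    have hapos : 0 < V a := by
      refine pos_iff_ne_zero.mpr fun h0 => ?_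
      have h1 : a.1 = a.2 := (hV.eq_zero_iff a.1 a.2).mp h0
      have h2 : δ ≤ |f a.1 - f a.2| := ha.2
      rw [h1, sub_self, abs_zero] at h2
      exact absurd hδ h2.not_gt
    refine ⟨min 1 (V a), lt_min one_pos hapos, fun p h₂ hp => ?_⟩
    by_cases h₁ : p.1 ∈ L
    · exact (min_le_right _ _).trans (hmin ⟨⟨h₁, h₂⟩, hp⟩)
    · exact (min_le_left _ _).trans (hout p h₁ h₂)

section

variable {S : Type*} [MeasurableSpace S]

theorem fst_of_mem_couplings {μ ν : Measure S} {ξ : Measure (S × S)} (h : ξ ∈ couplings μ ν)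
    {s : Set S} (hs : MeasurableSet s) : ξ (Prod.fst ⁻¹' s) = μ s := by
  rw [← h.2.1, Measure.fst_apply hs]

theorem snd_of_mem_couplings {μ ν : Measure S} {ξ : Measure (S × S)} (h : ξ ∈ couplings μ ν)
    {s : Set S} (hs : MeasurableSet s) : ξ (Prod.snd ⁻¹' s) = ν s := by
  rw [← h.2.2, Measure.snd_apply hs]

theorem exists_mem_couplings_lintegral_lt {V : S × S → ℝ≥0} {μ ν : Measure S} {ε : ℝ≥0∞}
    (h : wassersteinDivergence V μ ν < ε) : ∃ ξ ∈ couplings μ ν, ∫⁻ p, (V p : ℝ≥0∞) ∂ξ < ε := by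
  simpa only [wassersteinDivergence, iInf_lt_iff, exists_prop] using h

theorem eventually_exists_mem_couplings {V : S × S → ℝ≥0} {μ ν : ℕ → Measure S}
    (h : Tendsto (fun k => wassersteinDivergence V (μ k) (ν k)) atTop (𝓝 0))
    {ε : ℝ≥0∞} (hε : 0 < ε) :
    ∀ᶠ k in atTop, ∃ ξ ∈ couplings (μ k) (ν k), ∫⁻ p, (V p : ℝ≥0∞) ∂ξ < ε :=
  (h.eventually_lt_const hε).mono fun _ => exists_mem_couplings_lintegral_lt

theorem isProbabilityMeasure_of_tendsto {V : S × S → ℝ≥0} {μ : ℕ → Measure S} {θ : Measure S}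
    (h : TendstoInWassersteinDivergence V μ θ) : IsProbabilityMeasure θ := by
  obtain ⟨k, ξ, ⟨hξ, -, rfl⟩, -⟩ :=
    (eventually_exists_mem_couplings (ν := fun _ => θ) h one_pos).exists
  infer_instance

end

section

variable {S : Type*} [TopologicalSpace S] [PolishSpace S] [MeasurableSpace S] [BorelSpace S]

theorem IsDivergence.measurable {V : S × S → ℝ≥0} (hV : IsDivergence V) : Measurable V :=
  hV.lowerSemicontinuous.measurable

/-- Up to finitely many terms, `ν` is a tight sequence. -/
def EventuallyTight (ν : ℕ → Measure S) : Prop :=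
  ∀ ε : ℝ≥0∞, 0 < ε → ∃ K : Set S, IsCompact K ∧ ∀ᶠ k in atTop, ν k Kᶜ ≤ ε

theorem eventuallyTight_const (θ : Measure S) [IsFiniteMeasure θ] :
    EventuallyTight fun _ => θ := by
  intro ε hε
  obtain ⟨K, hK, h⟩ :=
    isTightMeasureSet_iff_exists_isCompact_measure_compl_le.mp (isTightMeasureSet_singleton (μ := θ)) ε hε
  exact ⟨K, hK, .of_forall fun _ => h θ rfl⟩

/-- Markov's inequality for the set of pairs whose divergence is large. -/
theorem IsDivergence.measure_le_div {V : S × S → ℝ≥0} (hV : IsDivergence V) {μ ν : Measure S}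
    {ξ : Measure (S × S)} (hξ : ξ ∈ couplings μ ν) {K : Set S} (hK : IsCompact K) {c : ℝ≥0}
    (hc : 0 < c) {B : Set (S × S)} (hB : ∀ p : S × S, p.2 ∈ K → p ∈ B → c ≤ V p) :
    ξ B ≤ ν Kᶜ + (∫⁻ p, (V p : ℝ≥0∞) ∂ξ) / c := by
  have hsub : B ⊆ Prod.snd ⁻¹' Kᶜ ∪ {p | (c : ℝ≥0∞) ≤ V p} := by
    intro p hp
    by_cases h : p.2 ∈ K
    · exact Or.inr (ENNReal.coe_le_coe.mpr (hB p h hp))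
    · exact Or.inl h
  calc ξ B ≤ ξ (Prod.snd ⁻¹' Kᶜ) + ξ {p | (c : ℝ≥0∞) ≤ V p} :=
        (measure_mono hsub).trans (measure_union_le _ _)
    _ ≤ _ := by
        rw [snd_of_mem_couplings hξ hK.measurableSet.compl]
        gcongr
        exact meas_ge_le_lintegral_div hV.measurable.coe_nnreal_ennreal.aemeasurable
          (by exact_mod_cast hc.ne') ENNReal.coe_ne_top

theorem EventuallyTight.of_tendsto_wassersteinDivergence {V : S × S → ℝ≥0} (hV : IsDivergence V)
    {μ ν : ℕ → Measure S} (hν : EventuallyTight ν)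
    (h : Tendsto (fun k => wassersteinDivergence V (μ k) (ν k)) atTop (𝓝 0)) :
    EventuallyTight μ := by
  intro ε hε
  have hε2 : 0 < ε / 2 := ENNReal.half_pos hε.ne'
  obtain ⟨K, hK, hνK⟩ := hν _ hε2
  obtain ⟨L, hL, hLV⟩ := hV.inf_compact 1 K hK
  refine ⟨L, hL, ?_⟩
  filter_upwards [hνK, eventually_exists_mem_couplings h hε2] with k hk ⟨ξ, hξ, hξV⟩
  rw [← fst_of_mem_couplings hξ hL.measurableSet.compl]
  refine (hV.measure_le_div hξ hK one_pos fun p h₂ h₁ => ?_).trans ?_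
  · exact_mod_cast hLV.trans (iInf₂_le p ⟨h₁, h₂⟩)
  · rw [ENNReal.coe_one, div_one, ← ENNReal.add_halves ε]
    exact add_le_add hk hξV.le

theorem abs_integral_sub_le_of_mem_couplings {μ ν : Measure S} {ξ : Measure (S × S)}
    (hξ : ξ ∈ couplings μ ν) (f : BoundedContinuousFunction S ℝ) {δ : ℝ} (hδ : 0 ≤ δ) :
    |∫ x, f x ∂μ - ∫ x, f x ∂ν| ≤
      δ + 2 * ‖f‖ * ξ.real {p | δ ≤ |f p.1 - f p.2|} := by
  obtain ⟨hprob, rfl, rfl⟩ := hξ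
  have hB : MeasurableSet {p : S × S | δ ≤ |f p.1 - f p.2|} :=
    (isClosed_le continuous_const (by fun_prop)).measurableSet
  have h1 : Integrable (fun p : S × S => f p.1) ξ :=
    (f.compContinuous ⟨Prod.fst, continuous_fst⟩).integrable ξ
  have h2 : Integrable (fun p : S × S => f p.2) ξ :=
    (f.compContinuous ⟨Prod.snd, continuous_snd⟩).integrable ξ
  have e1 : ∫ x, f x ∂ξ.fst = ∫ p, f p.1 ∂ξ :=
    integral_map measurable_fst.aemeasurable f.continuous.aestronglyMeasurable
  have e2 : ∫ x, f x ∂ξ.snd = ∫ p, f p.2 ∂ξ :=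
    integral_map measurable_snd.aemeasurable f.continuous.aestronglyMeasurable
  rw [e1, e2, ← integral_sub h1 h2]
  have hi : Integrable ({p : S × S | δ ≤ |f p.1 - f p.2|}.indicator fun _ => 2 * ‖f‖) ξ :=
    (integrable_const _).indicator hB
  calc |∫ p, (f p.1 - f p.2) ∂ξ| ≤ ∫ p, |f p.1 - f p.2| ∂ξ := abs_integral_le_integral_abs
    _ ≤ ∫ p, (δ + {p : S × S | δ ≤ |f p.1 - f p.2|}.indicator (fun _ => 2 * ‖f‖) p) ∂ξ := by
        refine integral_mono (h1.sub h2).abs ((integrable_const δ).add hi) fun p => ?_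
        by_cases hp : δ ≤ |f p.1 - f p.2|
        · have hd : |f p.1 - f p.2| ≤ 2 * ‖f‖ := f.dist_le_two_norm p.1 p.2
          simp only [Set.indicator_of_mem (show p ∈ {p : S × S | δ ≤ |f p.1 - f p.2|} from hp)]
          linarith
        · simp only [Set.indicator_of_notMem (show p ∉ {p : S × S | δ ≤ |f p.1 - f p.2|} from hp)]
          linarith
    _ = _ := by
        rw [integral_add (integrable_const δ) hi, integral_indicator_const _ hB]
        simp [mul_comm]

theorem tendsto_integral_sub_of_tendsto_wassersteinDivergence {V : S × S → ℝ≥0}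
    (hV : IsDivergence V) {μ ν : ℕ → Measure S} (hν : EventuallyTight ν)
    (h : Tendsto (fun k => wassersteinDivergence V (μ k) (ν k)) atTop (𝓝 0))
    (f : BoundedContinuousFunction S ℝ) :
    Tendsto (fun k => ∫ x, f x ∂μ k - ∫ x, f x ∂ν k) atTop (𝓝 0) := by
  rw [Metric.tendsto_nhds]
  intro r hr
  obtain ⟨ε, hε, hεr⟩ : ∃ ε : ℝ≥0, 0 < ε ∧ ε + 2 * ‖f‖ * (ε + ε) < r := by
    have hlim : Tendsto (fun t : ℝ => t + 2 * ‖f‖ * (t + t)) (𝓝[>] 0) (𝓝 0) := by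
      have : Continuous fun t : ℝ => t + 2 * ‖f‖ * (t + t) := by fun_prop
      simpa using (this.tendsto 0).mono_left nhdsWithin_le_nhds
    obtain ⟨t, ht, htpos⟩ := ((hlim.eventually_lt_const hr).and self_mem_nhdsWithin).exists
    exact ⟨⟨t, le_of_lt htpos⟩, htpos, ht⟩
  have hε' : (0 : ℝ≥0∞) < ε := by exact_mod_cast hε
  obtain ⟨K, hK, hνK⟩ := hν _ hε'
  obtain ⟨c, hc, hcV⟩ := hV.exists_pos_le hK f.continuous (NNReal.coe_pos.mpr hε)
  have hεc : (0 : ℝ≥0∞) < (ε * c : ℝ≥0) := by exact_mod_cast mul_pos hε hc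
  filter_upwards [hνK, eventually_exists_mem_couplings h hεc] with k hk ⟨ξ, hξ, hξV⟩
  have hm : ξ {p | (ε : ℝ) ≤ |f p.1 - f p.2|} ≤ (ε + ε : ℝ≥0) := by
    refine (hV.measure_le_div hξ hK hc hcV).trans ?_
    rw [ENNReal.coe_add]
    refine add_le_add hk (ENNReal.div_le_of_le_mul ?_)
    exact_mod_cast hξV.le
  have hm' : ξ.real {p | (ε : ℝ) ≤ |f p.1 - f p.2|} ≤ ε + ε :=
    ENNReal.toReal_le_coe_of_le_coe hm
  rw [Real.dist_eq, sub_zero]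
  calc _ ≤ _ := abs_integral_sub_le_of_mem_couplings hξ f ε.coe_nonneg
    _ ≤ ε + 2 * ‖f‖ * (ε + ε) := by gcongr
    _ < r := hεr

end

theorem mainTheorem3 {S : Type*} [TopologicalSpace S] [PolishSpace S]
    [MeasurableSpace S] [BorelSpace S]
    (V : S × S → ℝ≥0) (hV : IsDivergence V)
    (μ ν : ℕ → Measure S)
    (hμ : ∀ k, IsProbabilityMeasure (μ k)) (hν : ∀ k, IsProbabilityMeasure (ν k))
    (θμ θν : Measure S)
    (hμθ : TendstoInWassersteinDivergence V μ θμ)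
    (hνθ : TendstoInWassersteinDivergence V ν θν)
    (hμν : Tendsto (fun k => wassersteinDivergence V (μ k) (ν k)) atTop (𝓝 0)) :
    θμ = θν := by
  have := isProbabilityMeasure_of_tendsto hμθ
  have := isProbabilityMeasure_of_tendsto hνθ
  have hνt : EventuallyTight ν :=
    .of_tendsto_wassersteinDivergence hV (eventuallyTight_const θν) hνθ
  refine ext_of_forall_integral_eq_of_IsFiniteMeasure fun f => ?_
  have h1 := tendsto_integral_sub_of_tendsto_wassersteinDivergence hV
    (eventuallyTight_const θμ) hμθ f
  have h2 := tendsto_integral_sub_of_tendsto_wassersteinDivergence hV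
    (eventuallyTight_const θν) hνθ f
  have h3 := tendsto_integral_sub_of_tendsto_wassersteinDivergence hV hνt hμν f
  have h4 := (h3.sub h1).add h2
  simp only [sub_sub_sub_cancel_left, sub_add_sub_cancel, sub_zero, add_zero] at h4
  exact sub_eq_zero.mp (tendsto_nhds_unique tendsto_const_nhds h4)
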